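/- **Setting.** Let $\mathcal X$ be a complete, connected metric space with a Borel-regular measure $\mu$ that is doubling: there is $C_D\ge 1$ with $0<\mu(B(x,2r))\le C_D\,\mu(B(x,r))<\infty$ for all $x\in\mathcal X$, $r>0$. Let $\mathcal H=L^2(\mathcal X,\mathbb C^N;d\mu)$, and let $\Gamma:\mathcal D(\Gamma)\subset\mathcal H\to\mathcal H$ be an operator with the following properties. * (H1) $\Gamma$ is closed, densely defined and nilpotent, i.e. $\mathcal R(\Gamma)\subset\mathcal N(\Gamma)$. * (H6) There is a constant $m>0$ such that, for every bounded Lipschitz function $\xi:\mathcal X\to\mathbb C$, multiplication by $\xi$ preserves $\mathcal D(\Gamma)$, the commutator $M_\xi=[\Gamma,\xi I]$ is multiplication by a matrix-valued function, and $|M_\xi(x)|\le m\,\mathrm{Lip}\,\xi(x)$ for almost all $x$. Here $\mathrm{Lip}\,\xi(x)=\limsup_{y\to x}|\xi(x)-\xi(y)|/d(x,y)$, which is understood to be $0$ at isolated points. * (H7) For each open ball $B$, $\int_B\Gamma u\,d\mu=0$ for all $u\in\mathcal D(\Gamma)$ with $\operatorname{spt}u\subset B$, and $\int_B\Gamma^*v\,d\mu=0$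 for all $v\in\mathcal D(\Gamma^*)$ with $\operatorname{spt}v\subset B$. Let $\{Q_\alpha^k: k\in\mathbb Z,\ \alpha\in I_k\}$ be a countable system of open sets (dyadic cubes) with points $z_\alpha^k\in Q_\alpha^k$ and constants $\delta\in(0,1)$, $a_0>0$, $\eta>0$, $C_1,C_2<\infty$ such that: 1. $\mu(\mathcal X\setminus\bigcup_\alpha Q^k_\alpha)=0$ for all $k$; 2. if $l\ge k$, either $Q_\beta^l\subset Q_\alpha^k$ or $Q_\beta^l\cap Q_\alpha^k=\emptyset$; 3. for each $(k,\alpha)$ and each $l<k$ there is a unique $\beta$ with $Q_\alpha^k\subset Q_\beta^l$; 4. $\operatorname{diam}Q_\alpha^k\le C_1\delta^k$; 5. $B(z_\alpha^k,a_0\delta^k)\subset Q_\alpha^k$; 6. for all $k,\alpha$ and all $s>0$, $\mu\{x\in Q_\alpha^k: d(x,\mathcal X\setminus Q_\alpha^k)\le s\delta^k\}\le C_2s^\eta\mu(Q_\alpha^k)$, where $d(x,\emptyset)=\infty$. For $t>0$ let $\mathcal Q_t=\{Q_\alpha^j:\alpha\in I_j\}$, where $j$ is the integer with $\delta^{j+1}<t\le\delta^j$.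 **Lemma.** Let $\Upsilon$ be $\Gamma$, $\Gamma^*$ or $\Pi=\Gamma+\Gamma^*$ (with $\mathcal D(\Pi)=\mathcal D(\Gamma)\cap\mathcal D(\Gamma^*)$). Then for all $t>0$, $Q\in\mathcal Q_t$ and $u\in\mathcal D(\Upsilon)$, $$\left|\frac1{\mu(Q)}\int_Q\Upsilon u\,d\mu\right|^2\le C\,\frac1{t^\eta}\left(\frac1{\mu(Q)}\int_Q|u|^2\,d\mu\right)^{\eta/2}\left(\frac1{\mu(Q)}\int_Q|\Upsilon u|^2\,d\mu\right)^{1-\eta/2},$$ where the constant $C$ depends only on $C_1$, $C_2$, $a_0$, $\eta$, $p=\log_2C_D$ and the constant $m$ of (H6). (If $\eta>2$ and $\Upsilon u=0$ almost everywhere on $Q$, where the right-hand side contains a negative power of $0$, it is read as $0$.) -/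

import Mathlib

open MeasureTheory Filter Topology
open scoped ENNReal

universe u v

/-- The measure `μ` is doubling with constant `CD`: for all `x` and all `r > 0`,
`0 < μ(B(x,2r)) ≤ CD μ(B(x,r)) < ∞`. -/
def IsDoublingWith {X : Type u} [MetricSpace X] [MeasurableSpace X]
    (μ : Measure X) (CD : ℝ) : Prop :=
  1 ≤ CD ∧ ∀ (x : X) (r : ℝ), 0 < r →
    0 < μ (Metric.ball x (2 * r)) ∧
    μ (Metric.ball x (2 * r)) ≤ ENNReal.ofReal CD * μ (Metric.ball x r) ∧
    ENNReal.ofReal CD * μ (Metric.ball x r) < ∞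

/-- A system of dyadic cubes in the sense of Christ: `cube k i` are the cubes of level `k : ℤ`,
`center k i` their centres. The distance to the complement is taken in `[0,∞]`, so that the
distance to the empty set is `∞`. -/
structure IsChristDyadic {X : Type u} [MetricSpace X] [MeasurableSpace X] (μ : Measure X)
    (δ a₀ η C₁ C₂ : ℝ) {I : ℤ → Type v} (cube : ∀ k, I k → Set X)
    (center : ∀ k, I k → X) : Prop where
  delta_pos : 0 < δ
  delta_lt_one : δ < 1
  countable : ∀ k, Countable (I k)
  isOpen : ∀ k i, IsOpen (cube k i)
  center_mem : ∀ k i, center k i ∈ cube k i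
  cover : ∀ k, μ (⋃ i, cube k i)ᶜ = 0
  nested : ∀ k l, k ≤ l → ∀ (i : I k) (i' : I l),
    cube l i' ⊆ cube k i ∨ Disjoint (cube l i') (cube k i)
  ancestor : ∀ k l, l < k → ∀ i : I k, ∃! i' : I l, cube k i ⊆ cube l i'
  diam_le : ∀ k i, Metric.ediam (cube k i) ≤ ENNReal.ofReal (C₁ * δ ^ k)
  ball_subset : ∀ k i, Metric.ball (center k i) (a₀ * δ ^ k) ⊆ cube k i
  small_boundary : ∀ k i (s : ℝ), 0 < s →
    μ {x ∈ cube k i | Metric.infEDist x (cube k i)ᶜ ≤ ENNReal.ofReal (s * δ ^ k)} ≤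
      ENNReal.ofReal (C₂ * s ^ η) * μ (cube k i)

/-- The cubes at scale `t`: those of the level `j` with `δ^(j+1) < t ≤ δ^j`. -/
def cubesAtScale {X : Type u} {I : ℤ → Type v} (cube : ∀ k, I k → Set X) (δ t : ℝ) :
    Set (Set X) :=
  {Q | ∃ (j : ℤ) (i : I j), δ ^ (j + 1) < t ∧ t ≤ δ ^ j ∧ Q = cube j i}

/-- The Hilbert space `L²(X, ℂ^N; μ)`. -/
noncomputable abbrev L2 {X : Type u} [MeasurableSpace X] (μ : Measure X) (N : ℕ) :=
  Lp (EuclideanSpace ℂ (Fin N)) 2 μ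

/-- The pointwise Lipschitz constant `limsup_{y → x} |ξ x - ξ y| / d(x,y)`, with values in
`[0,∞]`; it is `0` at isolated points, where the limsup is along the trivial filter. -/
noncomputable def pointwiseLip {X : Type u} [MetricSpace X] (ξ : X → ℂ) (x : X) : ℝ≥0∞ :=
  limsup (fun y => ‖ξ x - ξ y‖ₑ / edist x y) (𝓝[≠] x)

/-- The closed (essential) support of a function defined almost everywhere. -/
def essSupport {X : Type u} [TopologicalSpace X] [MeasurableSpace X] {E : Type v} [Zero E]
    (μ : Measure X) (f : X → E) : Set X :=
  {x | ∀ U ∈ 𝓝 x, ¬ ∀ᵐ y ∂μ.restrict U, f y = 0}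

/-- A closed, densely defined operator whose range lies in its null space. -/
structure IsNilpotentOperator {H : Type u} [NormedAddCommGroup H] [InnerProductSpace ℂ H]
    (Γ : H →ₗ.[ℂ] H) : Prop where
  isClosed : Γ.IsClosed
  dense : Dense (Γ.domain : Set H)
  sq_zero : ∀ u : Γ.domain, ∃ h : Γ u ∈ Γ.domain, Γ ⟨Γ u, h⟩ = 0

/-- For every bounded Lipschitz `ξ : X → ℂ`, multiplication by `ξ` preserves the domain of `Γ`,
the commutator `[Γ, ξ]` is multiplication by a matrix valued function `M`, and
`|M x| ≤ m Lip ξ (x)` for almost all `x`. The element `w` is the product `ξ u`. -/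
def HasLipschitzCommutators {X : Type u} [MetricSpace X] [MeasurableSpace X] {μ : Measure X}
    {N : ℕ} (Γ : L2 μ N →ₗ.[ℂ] L2 μ N) (m : ℝ) : Prop :=
  ∀ ξ : X → ℂ, (∃ K, LipschitzWith K ξ) → (∃ b : ℝ, ∀ x, ‖ξ x‖ ≤ b) →
    ∃ M : X → EuclideanSpace ℂ (Fin N) →L[ℂ] EuclideanSpace ℂ (Fin N),
      AEStronglyMeasurable M μ ∧
      (∀ u : Γ.domain, ∃ w : Γ.domain,
        (∀ᵐ x ∂μ, (w : L2 μ N) x = ξ x • (u : L2 μ N) x) ∧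
        (∀ᵐ x ∂μ, Γ w x - ξ x • Γ u x = M x ((u : L2 μ N) x))) ∧
      ∀ᵐ x ∂μ, ‖M x‖ₑ ≤ ENNReal.ofReal m * pointwiseLip ξ x

/-- `∫_B T u dμ = 0` for every open ball `B` and every `u` in the domain of `T` with support
in `B`. -/
def HasCancellation {X : Type u} [MetricSpace X] [MeasurableSpace X] {μ : Measure X}
    {N : ℕ} (T : L2 μ N →ₗ.[ℂ] L2 μ N) : Prop :=
  ∀ (y : X) (r : ℝ), 0 < r → ∀ u : T.domain,
    essSupport μ (u : L2 μ N) ⊆ Metric.ball y r → ∫ x in Metric.ball y r, T u x ∂μ = 0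

/-! Let `ξ` be a cut-off that is 1 at the points of `Q` farther than `τ` from its complement and
vanishes near the complement. Since `ξu` is supported in `Q`, cancellation gives `∫_Q Υ(ξu) = 0`, so
`∫_Q Υu = ∫_Q ((1 - ξ)Υu - M_ξ u)`. This integrand lives on the boundary layer of width `τ`, where
`|M_ξ| ≤ 2m/τ`. Cauchy–Schwarz and the small boundary condition yield a bound in `τ`
(`norm_setIntegral_le_sqrt_boundary_mul`). The choice of `τ` as the ratio of the `L²` norms of `u`
and `Υu` on `Q` gives the claim (`le_interpolation_of_forall_le`). For `Γ*` and `Π`, the hypotheses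
on `Γ` pass to adjoints and sums. -/

/-! ### Pointwise Lipschitz constants and cut-offs -/

theorem pointwiseLip_le_of_lipschitzWith {X : Type u} [MetricSpace X] {ξ : X → ℂ} {K : NNReal}
    (h : LipschitzWith K ξ) (x : X) : pointwiseLip ξ x ≤ K := by
  refine limsup_le_of_le (by isBoundedDefault) (Eventually.of_forall fun y => ?_)
  refine ENNReal.div_le_of_le_mul ?_
  rw [← edist_eq_enorm_sub]
  exact h x y

/-- This kills the commutator wherever the cut-off is locally constant, hence off the boundary
layer. -/
theorem pointwiseLip_eq_zero_of_eventually_eq {X : Type u} [MetricSpace X] {ξ : X → ℂ} {x : X}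
    {c : ℂ} (h : ∀ᶠ y in 𝓝 x, ξ y = c) : pointwiseLip ξ x = 0 := by
  refine le_antisymm (limsup_le_of_le (by isBoundedDefault) ?_) (zero_le)
  filter_upwards [h.filter_mono nhdsWithin_le_nhds] with y hy
  simp [hy, h.self_of_nhds]

theorem pointwiseLip_star {X : Type u} [MetricSpace X] (ξ : X → ℂ) :
    pointwiseLip (fun x => star (ξ x)) = pointwiseLip ξ := by
  ext x
  unfold pointwiseLip
  congr 1
  ext y
  rw [← star_sub, enorm_eq_nnnorm, enorm_eq_nnnorm, nnnorm_star]

/-- A Lipschitz cut-off that is `1` well inside `Q` and vanishes near the complement of `Q`. -/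
theorem exists_lipschitz_cutoff {X : Type u} [MetricSpace X] (Q : Set X) {τ : ℝ} (hτ : 0 < τ) :
    ∃ ξ : X → ℂ, LipschitzWith (2 / τ).toNNReal ξ ∧ (∀ x, ‖ξ x‖ ≤ 1) ∧ (∀ x, ‖1 - ξ x‖ ≤ 1) ∧
      (∀ x, ENNReal.ofReal τ < Metric.infEDist x Qᶜ → ∀ᶠ y in 𝓝 x, ξ y = 1) ∧
      ∀ x ∉ Q, ∀ᶠ y in 𝓝 x, ξ y = 0 := by
  -- Thickening by only `τ/2` leaves a margin `τ/2` in which `ξ` is 0, so `ξ` vanishes on a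
  -- neighbourhood of every point outside `Q`; the price is the factor 2 in the Lipschitz constant.
  have hτ2 : 0 < τ / 2 := by positivity
  set E : Set X := {x | ENNReal.ofReal τ ≤ Metric.infEDist x Qᶜ} with hE
  set f := thickenedIndicator hτ2 E with hf
  have hf1 : ∀ x, (f x : ℝ) ≤ 1 := fun x => by
    exact_mod_cast thickenedIndicator_le_one hτ2 E x
  refine ⟨fun x => ((f x : ℝ) : ℂ), ?_, ?_, ?_, ?_, ?_⟩
  · have h := lipschitzWith_thickenedIndicator hτ2 E
    refine LipschitzWith.of_dist_le_mul fun x y => ?_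
    have h2 := h.dist_le_mul x y
    rw [NNReal.dist_eq] at h2
    rw [Complex.dist_eq, ← Complex.ofReal_sub, Complex.norm_real, Real.norm_eq_abs]
    refine h2.trans (le_of_eq ?_)
    congr 1
    rw [← Real.toNNReal_inv, inv_div]
  · intro x
    have : ‖((f x : ℝ) : ℂ)‖ = f x := by
      rw [Complex.norm_real, Real.norm_of_nonneg (NNReal.coe_nonneg (f x))]
    exact this.trans_le (hf1 x)
  · intro x
    rw [← Complex.ofReal_one, ← Complex.ofReal_sub, Complex.norm_real,
      Real.norm_of_nonneg (sub_nonneg.2 (hf1 x))]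
    linarith [(NNReal.coe_nonneg (f x))]
  · intro x hx
    have ho : IsOpen {x | ENNReal.ofReal τ < Metric.infEDist x Qᶜ} :=
      isOpen_lt continuous_const Metric.continuous_infEDist
    filter_upwards [ho.mem_nhds hx] with y hy
    have : f y = 1 := thickenedIndicator_one hτ2 E (le_of_lt hy)
    simp [this]
  · intro x hx
    have ho : IsOpen {x | Metric.infEDist x Qᶜ < ENNReal.ofReal (τ / 2)} :=
      isOpen_lt Metric.continuous_infEDist continuous_const
    have hx' : Metric.infEDist x Qᶜ < ENNReal.ofReal (τ / 2) := by
      rw [Metric.infEDist_zero_of_mem (by exact hx)]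
      exact ENNReal.ofReal_pos.2 hτ2
    filter_upwards [ho.mem_nhds hx'] with y hy
    have : f y = 0 := by
      refine thickenedIndicator_zero hτ2 E fun hmem => ?_
      rw [Metric.mem_thickening_iff_exists_edist_lt] at hmem
      obtain ⟨z, hz, hyz⟩ := hmem
      have h1 : Metric.infEDist z Qᶜ ≤ Metric.infEDist y Qᶜ + edist z y :=
        Metric.infEDist_le_infEDist_add_edist
      rw [edist_comm] at h1
      have h2 : Metric.infEDist y Qᶜ + edist y z <
          ENNReal.ofReal (τ / 2) + ENNReal.ofReal (τ / 2) := ENNReal.add_lt_add hy hyz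
      rw [← ENNReal.ofReal_add hτ2.le hτ2.le, add_halves] at h2
      exact absurd (hz.trans h1) (not_le.2 h2)
    simp [this]

/-! ### Commutators and cancellation for sums and adjoints -/

section Operators

variable {X : Type u} [MetricSpace X] [MeasurableSpace X] {μ : Measure X} {N : ℕ}

theorem HasLipschitzCommutators.add {S T : L2 μ N →ₗ.[ℂ] L2 μ N} {m n : ℝ} (hm : 0 ≤ m)
    (hn : 0 ≤ n) (hS : HasLipschitzCommutators S m) (hT : HasLipschitzCommutators T n) :
    HasLipschitzCommutators (S + T) (m + n) := by
  intro ξ hξ hb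
  obtain ⟨M₁, hM₁, h₁, hn₁⟩ := hS ξ hξ hb
  obtain ⟨M₂, hM₂, h₂, hn₂⟩ := hT ξ hξ hb
  refine ⟨fun x => M₁ x + M₂ x, hM₁.add hM₂, fun u => ?_, ?_⟩
  · obtain ⟨w₁, hw₁, hc₁⟩ := h₁ ⟨u, u.2.1⟩
    obtain ⟨w₂, hw₂, hc₂⟩ := h₂ ⟨u, u.2.2⟩
    have hw : (w₁ : L2 μ N) = w₂ := by
      refine Lp.ext ?_
      filter_upwards [hw₁, hw₂] with x h h'
      rw [h, h']
    refine ⟨⟨w₁, w₁.2, hw ▸ w₂.2⟩, hw₁, ?_⟩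
    have e₁ : (S + T) ⟨w₁, w₁.2, hw ▸ w₂.2⟩ = S w₁ + T w₂ := by
      rw [LinearPMap.add_apply]
      congr 2
      exact Subtype.ext hw
    have e₂ : (S + T) u = S ⟨u, u.2.1⟩ + T ⟨u, u.2.2⟩ := LinearPMap.add_apply S T u
    rw [e₁, e₂]
    filter_upwards [hc₁, hc₂, Lp.coeFn_add (S w₁) (T w₂),
      Lp.coeFn_add (S ⟨u, u.2.1⟩) (T ⟨u, u.2.2⟩)] with x a b c d
    have a' : S w₁ x - ξ x • S ⟨u, u.2.1⟩ x = M₁ x ((u : L2 μ N) x) := a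
    have b' : T w₂ x - ξ x • T ⟨u, u.2.2⟩ x = M₂ x ((u : L2 μ N) x) := b
    rw [c, d, Pi.add_apply, Pi.add_apply, add_apply, ← a', ← b', smul_add]
    abel
  · filter_upwards [hn₁, hn₂] with x a b
    rw [ENNReal.ofReal_add hm hn, add_mul]
    exact (enorm_add_le (M₁ x) (M₂ x)).trans (add_le_add a b)

/-- Formally `[T*, ξ] = -[T, ξ̄]*`, so the new matrix is minus the adjoint of the old one for `ξ̄`,
with the same norm. -/
theorem HasLipschitzCommutators.adjoint [BorelSpace X] {T : L2 μ N →ₗ.[ℂ] L2 μ N} {m : ℝ}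
    (hd : Dense (T.domain : Set (L2 μ N))) (hT : HasLipschitzCommutators T m) :
    HasLipschitzCommutators T.adjoint m := by
  rintro ξ ⟨K, hK⟩ ⟨b, hb⟩
  have hK' : LipschitzWith K fun x => star (ξ x) := by
    intro x y
    rw [edist_eq_enorm_sub, ← star_sub, enorm_eq_nnnorm, nnnorm_star, ← enorm_eq_nnnorm,
      ← edist_eq_enorm_sub]
    exact hK x y
  obtain ⟨M, hM, hc, hn⟩ := hT (fun x => star (ξ x)) ⟨K, hK'⟩
    ⟨b, fun x => by rw [norm_star]; exact hb x⟩
  rw [pointwiseLip_star] at hn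
  set A : X → EuclideanSpace ℂ (Fin N) →L[ℂ] EuclideanSpace ℂ (Fin N) :=
    fun x => -(ContinuousLinearMap.adjoint (M x)) with hA
  have hAm : AEStronglyMeasurable A μ :=
    (ContinuousLinearMap.adjoint.continuous.comp_aestronglyMeasurable hM).neg
  have hAn : ∀ x, ‖A x‖ₑ = ‖M x‖ₑ := fun x => by
    rw [hA, enorm_neg, enorm_eq_nnnorm, enorm_eq_nnnorm, LinearIsometryEquiv.nnnorm_map]
  have hAb : ∀ᵐ x ∂μ, ‖A x‖ ≤ (ENNReal.ofReal m * K).toReal := by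
    filter_upwards [hn] with x hx
    have : ‖A x‖ₑ ≤ ENNReal.ofReal m * K := by
      rw [hAn]
      exact hx.trans (mul_le_mul_right (pointwiseLip_le_of_lipschitzWith hK x) _)
    rw [← toReal_enorm]
    exact ENNReal.toReal_mono (by finiteness) this
  have mulξ : ∀ f : L2 μ N, MemLp (fun x => ξ x • f x) 2 μ := fun f =>
    MemLp.of_le_mul (c := b) (Lp.memLp f)
      (hK.continuous.aestronglyMeasurable.smul (Lp.aestronglyMeasurable f))
      (Eventually.of_forall fun x => by
        rw [norm_smul]; exact mul_le_mul_of_nonneg_right (hb x) (norm_nonneg _))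
  have mulA : ∀ f : L2 μ N, MemLp (fun x => A x (f x)) 2 μ := fun f =>
    MemLp.of_le_mul (c := (ENNReal.ofReal m * K).toReal) (Lp.memLp f)
      (isBoundedBilinearMap_apply.continuous.comp_aestronglyMeasurable
        (hAm.prodMk (Lp.aestronglyMeasurable f)))
      (hAb.mono fun x hx => (A x).le_of_opNorm_le hx _)
  refine ⟨A, hAm, fun v => ?_, hn.mono fun x hx => by rw [hAn]; exact hx⟩
  set w : L2 μ N := (mulξ v).toLp _ with hw
  set g : L2 μ N := (mulξ (T.adjoint v)).toLp _ + (mulA v).toLp _ with hg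
  have hwx : ∀ᵐ x ∂μ, w x = ξ x • (v : L2 μ N) x := MemLp.coeFn_toLp _
  have hgx : ∀ᵐ x ∂μ, g x = ξ x • T.adjoint v x + A x ((v : L2 μ N) x) := by
    filter_upwards [Lp.coeFn_add ((mulξ (T.adjoint v)).toLp _) ((mulA v).toLp _),
      (mulξ (T.adjoint v)).coeFn_toLp, (mulA v).coeFn_toLp] with x h1 h2 h3
    rw [hg, h1, Pi.add_apply, h2, h3]
  have key : ∀ u : T.domain, inner ℂ g (u : L2 μ N) = inner ℂ w (T u) := by
    intro u
    obtain ⟨w', hw', hc'⟩ := hc u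
    have hfa : inner ℂ (T.adjoint v) (w' : L2 μ N) = inner ℂ (v : L2 μ N) (T w') :=
      LinearPMap.adjoint_isFormalAdjoint hd v w'
    -- The pointwise identity is integrated with all terms added, so that only integrable inner
    -- products occur; adjunction of `v` against `ξ̄u` then cancels one term on each side.
    have hsum : inner ℂ g (u : L2 μ N) + inner ℂ (v : L2 μ N) (T w') =
        inner ℂ (T.adjoint v) (w' : L2 μ N) + inner ℂ w (T u) := by
      simp only [L2.inner_def]
      rw [← integral_add (L2.integrable_inner _ _) (L2.integrable_inner _ _),
        ← integral_add (L2.integrable_inner _ _) (L2.integrable_inner _ _)]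
      refine integral_congr_ae ?_
      filter_upwards [hwx, hgx, hw', hc'] with x e1 e2 e3 e4
      have e5 : T w' x = star (ξ x) • T u x + M x ((u : L2 μ N) x) := by
        rw [← e4]; abel
      rw [e1, e2, e3, e5]
      simp only [hA, inner_add_left, inner_add_right, inner_smul_left, inner_smul_right,
        neg_apply, inner_neg_left, ContinuousLinearMap.adjoint_inner_left,
        starRingEnd_apply]
      ring
    rw [hfa, add_comm] at hsum
    exact add_left_cancel hsum
  have hmem : w ∈ T.adjoint.domain := LinearPMap.mem_adjoint_domain_of_exists w ⟨g, key⟩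
  refine ⟨⟨w, hmem⟩, hwx, ?_⟩
  rw [LinearPMap.adjoint_apply_eq hd ⟨w, hmem⟩ key]
  filter_upwards [hgx] with x hx
  rw [hx, add_sub_cancel_left]

theorem HasCancellation.add {S T : L2 μ N →ₗ.[ℂ] L2 μ N}
    (hfin : ∀ (x : X) (r : ℝ), μ (Metric.ball x r) < ∞)
    (hS : HasCancellation S) (hT : HasCancellation T) : HasCancellation (S + T) := by
  intro y r hr u hu
  have : IsFiniteMeasure (μ.restrict (Metric.ball y r)) :=
    ⟨by rw [Measure.restrict_apply_univ]; exact hfin y r⟩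
  have hint : ∀ f : L2 μ N, IntegrableOn f (Metric.ball y r) μ := fun f =>
    ((Lp.memLp f).restrict _).integrable (by norm_num)
  have e : (S + T) u = S ⟨u, u.2.1⟩ + T ⟨u, u.2.2⟩ := LinearPMap.add_apply S T u
  rw [e, integral_congr_ae (ae_restrict_of_ae (Lp.coeFn_add _ _))]
  simp only [Pi.add_apply]
  rw [integral_add (hint _) (hint _), hS y r hr ⟨u, u.2.1⟩ hu, hT y r hr ⟨u, u.2.2⟩ hu, add_zero]

end Operators

/-! ### The boundary layer estimate and its optimisation -/

/-- The Cauchy--Schwarz inequality on a subset of finite measure. -/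
theorem setIntegral_norm_le_sqrt_mul_sqrt {X : Type u} [MeasurableSpace X] {μ : Measure X}
    {E : Type v} [NormedAddCommGroup E] {f : X → E} (hf : MemLp f 2 μ) {S Q : Set X}
    (hSQ : S ⊆ Q) (hS : μ S < ∞) :
    ∫ x in S, ‖f x‖ ∂μ ≤ √(μ.real S) * √(∫ x in Q, ‖f x‖ ^ 2 ∂μ) := by
  have : IsFiniteMeasure (μ.restrict S) := ⟨by rwa [Measure.restrict_apply_univ]⟩
  have h := integral_mul_le_Lp_mul_Lq_of_nonneg (μ := μ.restrict S) Real.HolderConjugate.two_two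
    (f := fun _ => (1 : ℝ)) (g := fun x => ‖f x‖) (Eventually.of_forall fun _ => zero_le_one)
    (Eventually.of_forall fun _ => norm_nonneg _) (memLp_const 1)
    (by simpa using (hf.restrict S).norm)
  simp only [one_mul, one_pow, integral_const, smul_eq_mul, mul_one,
    Real.rpow_two, ← Real.sqrt_eq_rpow, measureReal_restrict_apply_univ] at h
  refine h.trans (mul_le_mul_of_nonneg_left (Real.sqrt_le_sqrt ?_) (Real.sqrt_nonneg _))
  exact setIntegral_mono_set (hf.restrict Q).norm.integrable_sq
    (Eventually.of_forall fun _ => sq_nonneg _) hSQ.eventuallyLE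

theorem norm_setIntegral_le_sqrt_boundary_mul {X : Type u} [MetricSpace X] [MeasurableSpace X]
    [BorelSpace X] {μ : Measure X} {N : ℕ} {T : L2 μ N →ₗ.[ℂ] L2 μ N} {m : ℝ} (hm : 0 ≤ m)
    (hT : HasLipschitzCommutators T m) (hT' : HasCancellation T) {Q : Set X} (hQ : IsOpen Q)
    (hμQ : μ Q < ∞) {z : X} {r : ℝ} (hr : 0 < r) (hQr : Q ⊆ Metric.ball z r) {τ : ℝ} (hτ : 0 < τ)
    (u : T.domain) :
    ‖∫ x in Q, T u x ∂μ‖ ≤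
      √(μ.real {x ∈ Q | Metric.infEDist x Qᶜ ≤ ENNReal.ofReal τ}) *
        (√(∫ x in Q, ‖T u x‖ ^ 2 ∂μ) + 2 * m / τ * √(∫ x in Q, ‖(u : L2 μ N) x‖ ^ 2 ∂μ)) := by
  obtain ⟨ξ, hξ, hξ1, hξ2, hξone, hξzero⟩ := exists_lipschitz_cutoff Q hτ
  obtain ⟨M, -, hM, hMn⟩ := hT ξ ⟨_, hξ⟩ ⟨1, hξ1⟩
  obtain ⟨w, hw, hTw⟩ := hM u
  set S := {x ∈ Q | Metric.infEDist x Qᶜ ≤ ENNReal.ofReal τ} with hS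
  have hSQ : S ⊆ Q := fun x hx => hx.1
  have hμS : μ S < ∞ := (measure_mono hSQ).trans_lt hμQ
  have hSm : MeasurableSet S :=
    hQ.measurableSet.inter (isClosed_le Metric.continuous_infEDist continuous_const).measurableSet
  have : IsFiniteMeasure (μ.restrict Q) := ⟨by rwa [Measure.restrict_apply_univ]⟩
  have hint : ∀ f : L2 μ N, IntegrableOn f Q μ := fun f =>
    ((Lp.memLp f).restrict _).integrable (by norm_num)
  have hM0 : ∀ᵐ x ∂μ, (∃ c, ∀ᶠ y in 𝓝 x, ξ y = c) → M x = 0 := by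
    filter_upwards [hMn] with x hx ⟨c, hc⟩
    rw [pointwiseLip_eq_zero_of_eventually_eq hc, mul_zero] at hx
    rw [← ofReal_norm, nonpos_iff_eq_zero, ENNReal.ofReal_eq_zero] at hx
    exact norm_le_zero_iff.1 hx
  have hMb : ∀ᵐ x ∂μ, ‖M x‖ ≤ 2 * m / τ := by
    filter_upwards [hMn] with x hx
    have h1 : ‖M x‖ₑ ≤ ENNReal.ofReal (m * (2 / τ)) := by
      rw [ENNReal.ofReal_mul hm]
      exact hx.trans (mul_le_mul_right (pointwiseLip_le_of_lipschitzWith hξ x) _)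
    rw [← ofReal_norm, ENNReal.ofReal_le_ofReal_iff (by positivity)] at h1
    exact h1.trans_eq (by ring)
  have hsupp : essSupport μ (w : L2 μ N) ⊆ Metric.ball z r := by
    refine Set.Subset.trans (fun x hx => ?_) hQr
    by_contra hxQ
    have h0 := hξzero x hxQ
    obtain ⟨U, hU, hUo, hxU⟩ := eventually_nhds_iff.1 h0
    refine hx U (hUo.mem_nhds hxU) ?_
    rw [ae_restrict_iff' hUo.measurableSet]
    filter_upwards [hw] with y hy hyU
    rw [hy, hU y hyU, zero_smul]
  -- Off `Q` both `ξ` and the commutator vanish, so the integral over the ball reduces to `Q`.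
  have hw0 : ∫ x in Q, T w x ∂μ = 0 := by
    rw [← hT' z r hr w hsupp]
    symm
    refine setIntegral_eq_of_subset_of_ae_sdiff_eq_zero
      Metric.isOpen_ball.measurableSet.nullMeasurableSet hQr ?_
    filter_upwards [hTw, hM0] with x h1 h2 hx
    have h3 := hξzero x hx.2
    rw [h2 ⟨0, h3⟩, h3.self_of_nhds] at h1
    simpa using h1
  have hbound : ∀ᵐ x ∂μ, x ∈ Q → ‖T u x - T w x‖ ≤
      S.indicator (fun x => ‖T u x‖ + 2 * m / τ * ‖(u : L2 μ N) x‖) x := by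
    filter_upwards [hTw, hM0, hMb] with x h1 h2 h3 hxQ
    have h4 : T u x - T w x = (1 - ξ x) • T u x - M x ((u : L2 μ N) x) := by
      rw [← h1, sub_smul, one_smul]; abel
    by_cases hx : x ∈ S
    · rw [Set.indicator_of_mem hx, h4]
      refine (norm_sub_le _ _).trans (add_le_add ?_ ((M x).le_of_opNorm_le h3 _))
      rw [norm_smul]
      exact mul_le_of_le_one_left (norm_nonneg _) (hξ2 x)
    · have h5 := hξone x (not_le.1 fun h => hx ⟨hxQ, h⟩)
      rw [Set.indicator_of_notMem hx, h4, h2 ⟨1, h5⟩, h5.self_of_nhds]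
      simp
  have hintS : ∀ f : L2 μ N, IntegrableOn (fun x => ‖f x‖) S μ := fun f =>
    ((hint f).mono_set hSQ).norm
  calc ‖∫ x in Q, T u x ∂μ‖ = ‖∫ x in Q, (T u x - T w x) ∂μ‖ := by
        rw [integral_sub (hint _) (hint _), hw0, sub_zero]
    _ ≤ ∫ x in Q, S.indicator (fun x => ‖T u x‖ + 2 * m / τ * ‖(u : L2 μ N) x‖) x ∂μ := by
        refine norm_integral_le_of_norm_le ?_ ((ae_restrict_iff' hQ.measurableSet).2 hbound)
        exact (((hint _).norm.add ((hint _).norm.const_mul _)).indicator hSm)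
    _ = ∫ x in S, ‖T u x‖ ∂μ + 2 * m / τ * ∫ x in S, ‖(u : L2 μ N) x‖ ∂μ := by
        rw [setIntegral_indicator hSm, Set.inter_eq_self_of_subset_right hSQ,
          integral_add (hintS _) ((hintS _).const_mul _), integral_const_mul]
    _ ≤ _ := by
        have h1 := setIntegral_norm_le_sqrt_mul_sqrt (Lp.memLp (T u)) hSQ hμS
        have h2 := setIntegral_norm_le_sqrt_mul_sqrt (Lp.memLp (u : L2 μ N))
          hSQ hμS
        have h3 := mul_le_mul_of_nonneg_left h2 (show 0 ≤ 2 * m / τ by positivity)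
        calc _ ≤ _ := add_le_add h1 h3
          _ = _ := by ring

/-- Optimising a family of bounds over its parameter `τ`. -/
theorem le_interpolation_of_forall_le {a A B c k t η : ℝ} (ha : 0 ≤ a) (hA : 0 ≤ A) (hB : 0 ≤ B)
    (hc : 0 ≤ c) (hk : 0 ≤ k) (ht : 0 < t) (hη : 0 < η) (haB : a ≤ B)
    (h : ∀ τ : ℝ, 0 < τ → a ≤ c * (τ / t) ^ η * (√B + k / τ * √A) ^ 2) :
    a ≤ (1 + c * (1 + k) ^ 2) * (1 / t ^ η) * A ^ (η / 2) * B ^ (1 - η / 2) := by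
  have hC : 0 ≤ c * (1 + k) ^ 2 := by positivity
  rcases hB.eq_or_lt with hB0 | hB0
  -- The right side is nonnegative even for a negative exponent, as `Real.rpow` then sends 0 to 0.
  · have : a = 0 := le_antisymm (hB0 ▸ haB) ha
    rw [this]; positivity
  rcases hA.eq_or_lt with hA0 | hA0
  -- With `A = 0` the optimal `τ` would be 0, so it is reached as a limit.
  · have hlim : Tendsto (fun τ : ℝ => c * (τ / t) ^ η * B) (𝓝[>] 0) (𝓝 (c * (0 / t) ^ η * B)) := by
      have : Continuous fun τ : ℝ => c * (τ / t) ^ η * B :=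
        (continuous_const.mul ((continuous_id.div_const t).rpow_const
          fun _ => Or.inr hη.le)).mul continuous_const
      exact (this.tendsto 0).mono_left nhdsWithin_le_nhds
    rw [zero_div, Real.zero_rpow hη.ne', mul_zero, zero_mul] at hlim
    have h0 : a ≤ 0 := by
      refine ge_of_tendsto hlim ?_
      filter_upwards [self_mem_nhdsWithin] with τ hτ
      have := h τ hτ
      rwa [← hA0, Real.sqrt_zero, mul_zero, add_zero, Real.sq_sqrt hB] at this
    exact h0.trans (by positivity)
  -- This `τ` balances the two terms: `k / τ * √A = k * √B`.
  set τ := √A / √B with hτd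
  have hsA : 0 < √A := Real.sqrt_pos.2 hA0
  have hsB : 0 < √B := Real.sqrt_pos.2 hB0
  have hτ : 0 < τ := div_pos hsA hsB
  have key : (τ / t) ^ η * B = 1 / t ^ η * A ^ (η / 2) * B ^ (1 - η / 2) := by
    rw [Real.div_rpow hτ.le ht.le, hτd, Real.div_rpow hsA.le hsB.le, Real.rpow_sub hB0,
      Real.rpow_one, Real.sqrt_eq_rpow, Real.sqrt_eq_rpow, ← Real.rpow_mul hA, ← Real.rpow_mul hB]
    rw [show 1 / 2 * η = η / 2 by ring]
    ring
  have hR : (1 + c * (1 + k) ^ 2) * (1 / t ^ η) * A ^ (η / 2) * B ^ (1 - η / 2) =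
      (1 + c * (1 + k) ^ 2) * ((τ / t) ^ η * B) := by rw [key]; ring
  rw [hR]
  have hp : 0 ≤ (τ / t) ^ η * B := by positivity
  rcases le_total t τ with hle | hle
  -- For `τ ≥ t` the trivial bound `a ≤ B` suffices; it accounts for the summand 1 in the constant.
  · have h1 : 1 ≤ (τ / t) ^ η := Real.one_le_rpow ((one_le_div ht).2 hle) hη.le
    calc a ≤ 1 * (1 * B) := by linarith
      _ ≤ (1 + c * (1 + k) ^ 2) * ((τ / t) ^ η * B) := by gcongr; linarith
  · have h2 : k / τ * √A = k * √B := by rw [hτd]; field_simp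
    have h1 := h τ hτ
    rw [h2, show √B + k * √B = (1 + k) * √B by ring, mul_pow, Real.sq_sqrt hB] at h1
    calc a ≤ _ := h1
      _ = c * (1 + k) ^ 2 * ((τ / t) ^ η * B) := by ring
      _ ≤ _ := by gcongr; linarith

theorem norm_setAverage_sq_le {X : Type u} [MetricSpace X] [MeasurableSpace X] [BorelSpace X]
    {μ : Measure X} {N : ℕ} {T : L2 μ N →ₗ.[ℂ] L2 μ N} {m : ℝ} (hm : 0 ≤ m)
    (hT : HasLipschitzCommutators T m) (hT' : HasCancellation T) {Q : Set X} (hQ : IsOpen Q)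
    (hQ0 : 0 < μ Q) (hμQ : μ Q < ∞) {z : X} {r : ℝ} (hr : 0 < r) (hQr : Q ⊆ Metric.ball z r)
    {C₂ η ℓ t : ℝ} (hη : 0 < η) (ht : 0 < t) (htℓ : t ≤ ℓ)
    (hbd : ∀ s : ℝ, 0 < s → μ {x ∈ Q | Metric.infEDist x Qᶜ ≤ ENNReal.ofReal (s * ℓ)} ≤
      ENNReal.ofReal (C₂ * s ^ η) * μ Q) (u : T.domain) :
    ‖⨍ x in Q, T u x ∂μ‖ ^ 2 ≤
      (1 + |C₂| * (1 + 2 * m) ^ 2) * (1 / t ^ η) * (⨍ x in Q, ‖(u : L2 μ N) x‖ ^ 2 ∂μ) ^ (η / 2) *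
        (⨍ x in Q, ‖T u x‖ ^ 2 ∂μ) ^ (1 - η / 2) := by
  have hℓ : 0 < ℓ := ht.trans_le htℓ
  have hV : 0 < μ.real Q := ENNReal.toReal_pos hQ0.ne' hμQ.ne
  simp only [setAverage_eq, norm_smul, smul_eq_mul, norm_inv, Real.norm_of_nonneg hV.le]
  set V := μ.real Q with hVd
  set a := ∫ x in Q, ‖(u : L2 μ N) x‖ ^ 2 ∂μ with had
  set b := ∫ x in Q, ‖T u x‖ ^ 2 ∂μ with hbdd
  have ha : 0 ≤ a := integral_nonneg fun _ => sq_nonneg _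
  have hb : 0 ≤ b := integral_nonneg fun _ => sq_nonneg _
  refine le_interpolation_of_forall_le (by positivity) (by positivity) (by positivity)
    (abs_nonneg _) (by positivity) ht hη ?_ fun τ hτ => ?_
  · have h1 : ‖∫ x in Q, T u x ∂μ‖ ≤ √V * √b := (norm_integral_le_integral_norm _).trans
      (setIntegral_norm_le_sqrt_mul_sqrt (Lp.memLp (T u)) subset_rfl hμQ)
    calc (V⁻¹ * ‖∫ x in Q, T u x ∂μ‖) ^ 2 ≤ (V⁻¹ * (√V * √b)) ^ 2 := by gcongr
      _ = V⁻¹ * b := by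
        rw [mul_pow, mul_pow, Real.sq_sqrt hV.le, Real.sq_sqrt hb]; field_simp
  · have h1 := norm_setIntegral_le_sqrt_boundary_mul hm hT hT' hQ hμQ hr hQr hτ u
    set σ := μ.real {x ∈ Q | Metric.infEDist x Qᶜ ≤ ENNReal.ofReal τ} with hσ
    have hσ' : σ ≤ |C₂| * (τ / t) ^ η * V := by
      -- The layer of width `τ` is `s = τ / ℓ` in units of the cube scale, and `t ≤ ℓ` allows `t` in
      -- its place.
      have h2 := hbd (τ / ℓ) (by positivity)
      rw [div_mul_cancel₀ _ hℓ.ne'] at h2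
      have h3 := ENNReal.toReal_mono (by finiteness) h2
      rw [ENNReal.toReal_mul, ENNReal.toReal_ofReal'] at h3
      refine h3.trans (mul_le_mul_of_nonneg_right ?_ hV.le)
      refine max_le ?_ (by positivity)
      calc C₂ * (τ / ℓ) ^ η ≤ |C₂| * (τ / ℓ) ^ η := by gcongr; exact le_abs_self _
        _ ≤ |C₂| * (τ / t) ^ η := by gcongr
    have hsqrt : √(V⁻¹ * b) + 2 * m / τ * √(V⁻¹ * a) = (√V)⁻¹ * (√b + 2 * m / τ * √a) := by
      rw [Real.sqrt_mul (by positivity), Real.sqrt_mul (by positivity), Real.sqrt_inv]; ring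
    calc (V⁻¹ * ‖∫ x in Q, T u x ∂μ‖) ^ 2 ≤ (V⁻¹ * (√σ * (√b + 2 * m / τ * √a))) ^ 2 := by
          gcongr
      _ = V⁻¹ ^ 2 * σ * (√b + 2 * m / τ * √a) ^ 2 := by
          rw [mul_pow, mul_pow, Real.sq_sqrt measureReal_nonneg]; ring
      _ ≤ V⁻¹ ^ 2 * (|C₂| * (τ / t) ^ η * V) * (√b + 2 * m / τ * √a) ^ 2 := by gcongr
      _ = _ := by
          rw [hsqrt, mul_pow (√V)⁻¹, inv_pow (√V), Real.sq_sqrt hV.le]; field_simp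

theorem mainTheorem4
    (C₁ C₂ a₀ η CD m : ℝ) (ha₀ : 0 < a₀) (hη : 0 < η) (hm : 0 < m) :
    ∃ C : ℝ, 0 < C ∧
      ∀ (X : Type u) [MetricSpace X] [CompleteSpace X] [ConnectedSpace X]
        [MeasurableSpace X] [BorelSpace X] (μ : Measure X), IsDoublingWith μ CD →
      ∀ (δ : ℝ) (I : ℤ → Type v) (cube : ∀ k, I k → Set X) (center : ∀ k, I k → X),
        IsChristDyadic μ δ a₀ η C₁ C₂ cube center →
      ∀ (N : ℕ) (Γ : L2 μ N →ₗ.[ℂ] L2 μ N),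
        IsNilpotentOperator Γ → HasLipschitzCommutators Γ m →
        HasCancellation Γ → HasCancellation Γ.adjoint →
      ∀ Υ : L2 μ N →ₗ.[ℂ] L2 μ N, Υ = Γ ∨ Υ = Γ.adjoint ∨ Υ = Γ + Γ.adjoint →
      ∀ (t : ℝ), 0 < t → ∀ Q ∈ cubesAtScale cube δ t, ∀ u : Υ.domain,
        ‖⨍ x in Q, Υ u x ∂μ‖ ^ 2 ≤
          C * (1 / t ^ η) * (⨍ x in Q, ‖(u : L2 μ N) x‖ ^ 2 ∂μ) ^ (η / 2) *
            (⨍ x in Q, ‖Υ u x‖ ^ 2 ∂μ) ^ (1 - η / 2) := by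
  -- The commutator bounds of `Γ` and `Γ*` add up to `m + m` for `Π`; the absolute value covers
  -- either sign of `C₂`.
  refine ⟨1 + |C₂| * (1 + 2 * (m + m)) ^ 2, by positivity, ?_⟩
  intro X _ _ _ _ _ μ hμ δ I cube center hcube N Γ hΓ hcomm hcanc hcanc' Υ hΥ t ht Q hQ u
  obtain ⟨j, i, -, htj, rfl⟩ := hQ
  have hfin : ∀ (x : X) (r : ℝ), μ (Metric.ball x r) < ∞ := by
    intro x r
    rcases le_or_gt r 0 with hr | hr
    · simp [Metric.ball_eq_empty.2 hr]
    · have h := (hμ.2 x r hr).2.2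
      have h1 : 1 ≤ ENNReal.ofReal CD := ENNReal.one_le_ofReal.2 hμ.1
      exact (le_mul_of_one_le_left zero_le h1).trans_lt h
  have hδj : 0 < δ ^ j := zpow_pos hcube.delta_pos j
  have hpos : 0 < μ (cube j i) := by
    have h := (hμ.2 (center j i) (a₀ * δ ^ j / 2) (by positivity)).1
    rw [mul_div_cancel₀ _ two_ne_zero] at h
    exact h.trans_le (measure_mono (hcube.ball_subset j i))
  have hsub : cube j i ⊆ Metric.ball (center j i) (|C₁ * δ ^ j| + 1) := by
    intro x hx
    have h := (Metric.edist_le_ediam_of_mem hx (hcube.center_mem j i)).trans (hcube.diam_le j i)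
    rw [edist_dist, ENNReal.ofReal_le_ofReal_iff'] at h
    rw [Metric.mem_ball]
    rcases h with h | h
    · linarith [le_abs_self (C₁ * δ ^ j)]
    · linarith [abs_nonneg (C₁ * δ ^ j)]
  have hmono : ∀ {T : L2 μ N →ₗ.[ℂ] L2 μ N}, HasLipschitzCommutators T m →
      HasLipschitzCommutators T (m + m) := by
    intro T hT ξ h1 h2
    obtain ⟨M, hM, hMc, hMn⟩ := hT ξ h1 h2
    exact ⟨M, hM, hMc, hMn.mono fun x hx =>
      hx.trans (mul_le_mul_left (ENNReal.ofReal_le_ofReal (by linarith)) _)⟩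
  have hadj := hcomm.adjoint hΓ.dense
  have hΥc : HasLipschitzCommutators Υ (m + m) ∧ HasCancellation Υ := by
    rcases hΥ with rfl | rfl | rfl
    · exact ⟨hmono hcomm, hcanc⟩
    · exact ⟨hmono hadj, hcanc'⟩
    · exact ⟨hcomm.add hm.le hm.le hadj, hcanc.add hfin hcanc'⟩
  exact norm_setAverage_sq_le (by positivity) hΥc.1 hΥc.2 (hcube.isOpen j i) hpos
    ((measure_mono hsub).trans_lt (hfin _ _)) (by positivity) hsub hη ht htj
    (hcube.small_boundary j i) u
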